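/- For a group $G$ generated by a finite set $\mathcal S$, let $\ell_{\mathcal S}(g)$ denote the least length of a word in the elements of $\mathcal S$ and their inverses that represents $g\in G$. A finitely generated group $G$ is called effectively conjugacy separable if for every finite generating set $\mathcal S$ of $G$ there is a computable function $B:\mathbb N\to\mathbb N$ such that, for every pair of non-conjugate elements $g,h\in G$, there is a finite quotient $Q$ of $G$ in which the images of $g$ and $h$ are not conjugate and with $|Q|\le B(\ell_{\mathcal S}(g)+\ell_{\mathcal S}(h))$. Proposition 5.4. Every finitely generated free group is effectively conjugacy separable. Moreover, for every prime $p>2$: (a) If $F$ is a finitely generated free group and $\mathcal S$ is a finite generating set of $F$, there is a computable function $B:\mathbb N\to\mathbb N$ such that, for all non-conjugate $g,h\in F$, there is a characteristic subgroup $K$ of $F$ such that $F/K$ is a finite $p$-group of order at most $B(\ell_{\mathcal S}(g)+\ell_{\mathcal S}(h))$ in which the images of $g$ and $h$ are not conjugate. (b) There is a computable function $B:\mathbb N\to\mathbb N$ such that, for every free group $F$ with a finite free basis $\mathcal S$ with $m$ elements and all non-conjugate $g,h\in F$, there is a normal subgroup $K$ of $F$ such that $F/K$ is a finite $p$-group of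 order $q\le B(\ell_{\mathcal S}(g)+\ell_{\mathcal S}(h))$ in which the images of $g$ and $h$ are not conjugate; and there is a characteristic subgroup $L\le K$ of $F$ such that $F/L$ is a finite $p$-group of order at most $q^{q^m}$, in which the images of $g$ and $h$ are not conjugate either. -/

import Mathlib

/-- The word length of `g` with respect to `S`: the least length of a word in the elements of `S`
and their inverses that represents `g`. (If `S` generates `G`, such a word exists for every `g`.) -/
noncomputable def wordLength {G : Type*} [Group G] (S : Set G) (g : G) : ℕ :=
  sInf {n : ℕ | ∃ l : List G, l.length = n ∧ (∀ x ∈ l, x ∈ S ∨ x⁻¹ ∈ S) ∧ l.prod = g}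

/-- The images of `g` and `h` in the quotient `G ⧸ K` are not conjugate. -/
def SeparatesConj {G : Type*} [Group G] (K : Subgroup G) [K.Normal] (g h : G) : Prop :=
  ¬ IsConj (QuotientGroup.mk' K g) (QuotientGroup.mk' K h)

/-- Effective conjugacy separability of a finitely generated group `G`: `G` is finitely generated
and, for every finite generating set `S`, there is a computable function `B` such that any two
non-conjugate elements `g`, `h` have non-conjugate images in a finite quotient of `G` of order at
most `B (ℓ_S(g) + ℓ_S(h))`. -/
def EffectivelyConjugacySeparable (G : Type*) [Group G] : Prop :=
  Group.FG G ∧ ∀ S : Set G, S.Finite → Subgroup.closure S = ⊤ →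
    ∃ B : ℕ → ℕ, Computable B ∧ ∀ g h : G, ¬ IsConj g h →
      ∃ (K : Subgroup G) (_ : K.Normal), Finite (G ⧸ K) ∧
        Nat.card (G ⧸ K) ≤ B (wordLength S g + wordLength S h) ∧ SeparatesConj K g h

/-- The refinement for a prime `p` in which the finite quotients are `p`-groups and
their kernels are characteristic subgroups. -/
def EffectivelyCharPConjugacySeparable (p : ℕ) (G : Type*) [Group G] : Prop :=
  Group.FG G ∧ ∀ S : Set G, S.Finite → Subgroup.closure S = ⊤ →
    ∃ B : ℕ → ℕ, Computable B ∧ ∀ g h : G, ¬ IsConj g h →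
      ∃ (K : Subgroup G) (_ : K.Characteristic), Finite (G ⧸ K) ∧ IsPGroup p (G ⧸ K) ∧
        Nat.card (G ⧸ K) ≤ B (wordLength S g + wordLength S h) ∧ SeparatesConj K g h

/-! Non-conjugate elements are first separated in some finite group `G`, and the separation is then
transferred to a `p`-group.

Finite group: reduce both elements cyclically and let `L`, of length `n`, be the longer word. Its
letters label an `n`-cycle, on which each generator is a partial injection that extends to a
permutation. Traversing edge `k` in the direction of `L` adds `e_k` in `(ℤ/3)^n`. Read once around,
`L` returns to its starting vertex with weight `(1, …, 1)`. Having such a vertex is invariant under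
conjugacy, and a word of at most `n` letters has one only if it traverses each edge once along the
cycle, which makes it a rotation of `L` (`not_isConj_cycleAction`).

Transfer (`exists_isPGroup_not_isConj`): deform the image `a` of a generator to `(1 - X) + X a`.
Modulo `X ^ N` these are units congruent to `1` modulo `X`, which form a finite `p`-group; at `X =
1` they give back `G`. Coefficient sums over a conjugacy class of `G` are invariant under
conjugation by units and, after clearing denominators, polynomial in `X` of bounded degree. For
large `N`, agreement modulo `X ^ N` is thus agreement as polynomials, which fails at `X = 1`.

All bounds are explicit and primitive recursive. Intersecting the kernels of all homomorphisms to
the quotient makes the kernel characteristic. -/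

/-! ### Trace functions on group algebras -/

/-- The sum of the coefficients of an element of a group algebra over the conjugacy class of `c`. -/
noncomputable def classCoeff {G : Type*} [Group G] [Fintype G] (R : Type*) [CommRing R] (c : G) :
    MonoidAlgebra R G →ₗ[R] R :=
  open Classical in
  { toFun := fun x => ∑ y with IsConj c y, x.coeff y
    map_add' := fun x y => by simp [Finset.sum_add_distrib]
    map_smul' := fun r x => by simp [Finset.mul_sum] }

theorem isConj_mul_comm {G : Type*} [Group G] (a b : G) : IsConj (a * b) (b * a) :=
  isConj_iff.2 ⟨b, by group⟩

section ClassCoeff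

variable {G : Type*} [Group G] [Fintype G] {R : Type*} [CommRing R]

open Classical in
theorem classCoeff_apply (c : G) (x : MonoidAlgebra R G) :
    classCoeff R c x = ∑ y with IsConj c y, x.coeff y := rfl

open Classical in
theorem classCoeff_single (c a : G) (r : R) :
    classCoeff R c (MonoidAlgebra.single a r) = if IsConj c a then r else 0 := by
  simp [classCoeff_apply, Finsupp.single_apply, Finset.sum_ite_eq]

/-- By bilinearity this reduces to group elements, where `a * b` and `b * a` are conjugate. -/
theorem classCoeff_mul_comm (c : G) (x y : MonoidAlgebra R G) :
    classCoeff R c (x * y) = classCoeff R c (y * x) := by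
  classical
  induction x using MonoidAlgebra.induction_linear with
  | zero => simp
  | add x₁ x₂ h₁ h₂ => simp [add_mul, mul_add, h₁, h₂]
  | single a r =>
    induction y using MonoidAlgebra.induction_linear with
    | zero => simp
    | add y₁ y₂ h₁ h₂ => simp [add_mul, mul_add, h₁, h₂]
    | single b s =>
      have : IsConj c (a * b) ↔ IsConj c (b * a) :=
        ⟨fun h => h.trans (isConj_mul_comm a b), fun h => h.trans (isConj_mul_comm b a)⟩
      simp only [MonoidAlgebra.single_mul_single, classCoeff_single, this, mul_comm r s]

theorem classCoeff_eq_of_isConj (c : G) {u v : (MonoidAlgebra R G)ˣ} (h : IsConj u v) :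
    classCoeff R c (u : MonoidAlgebra R G) = classCoeff R c v := by
  obtain ⟨w, rfl⟩ := isConj_iff.1 h
  rw [Units.val_mul, classCoeff_mul_comm, ← Units.val_mul]
  congr 2
  group

theorem classCoeff_mapRingHom {S : Type*} [CommRing S] (σ : R →+* S) (c : G)
    (x : MonoidAlgebra R G) :
    classCoeff S c (MonoidAlgebra.mapRingHom G σ x) = σ (classCoeff R c x) := by
  simp [classCoeff_apply, map_sum]

end ClassCoeff

open Polynomial

/-! ### Deforming group elements to the identity -/

section Deformation

variable {G : Type*} [Group G] {k : Type*} [CommRing k]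

/-- All coefficients of an element of `k[X][G]` have degree at most `n`. -/
def CoeffDegreeLE (n : ℕ) (x : MonoidAlgebra k[X] G) : Prop :=
  ∀ g, (x.coeff g).natDegree ≤ n

theorem CoeffDegreeLE.mul {m n : ℕ} {x y : MonoidAlgebra k[X] G} (hx : CoeffDegreeLE m x)
    (hy : CoeffDegreeLE n y) : CoeffDegreeLE (m + n) (x * y) := by
  intro g
  rw [MonoidAlgebra.coeff_mul_apply_left]
  exact natDegree_sum_le_of_forall_le _ _ fun h _ =>
    natDegree_mul_le.trans (add_le_add (hx h) (hy _))

omit [Group G] in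
theorem CoeffDegreeLE.mono {m n : ℕ} {x : MonoidAlgebra k[X] G} (hx : CoeffDegreeLE m x)
    (h : m ≤ n) : CoeffDegreeLE n x := fun g => (hx g).trans h

theorem CoeffDegreeLE.add {n : ℕ} {x y : MonoidAlgebra k[X] G} (hx : CoeffDegreeLE n x)
    (hy : CoeffDegreeLE n y) : CoeffDegreeLE n (x + y) := fun g =>
  natDegree_add_le_of_degree_le (hx g) (hy g)

omit [Group G] in
theorem CoeffDegreeLE.sum {ι : Type*} {n : ℕ} {s : Finset ι} {x : ι → MonoidAlgebra k[X] G}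
    (hx : ∀ i ∈ s, CoeffDegreeLE n (x i)) : CoeffDegreeLE n (∑ i ∈ s, x i) := fun g => by
  rw [MonoidAlgebra.coeff_sum, Finsupp.finsetSum_apply]
  exact natDegree_sum_le_of_forall_le _ _ fun i hi => hx i hi g

omit [Group G] in
theorem coeffDegreeLE_single (a : G) {n : ℕ} {q : k[X]} (hq : q.natDegree ≤ n) :
    CoeffDegreeLE n (MonoidAlgebra.single a q) := fun g => by
  classical
  rw [MonoidAlgebra.coeff_single, Finsupp.single_apply]
  split_ifs <;> simp [hq]

theorem CoeffDegreeLE.classCoeff [Fintype G] {n : ℕ} {x : MonoidAlgebra k[X] G}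
    (hx : CoeffDegreeLE n x) (c : G) : (classCoeff k[X] c x).natDegree ≤ n :=
  natDegree_sum_le_of_forall_le _ _ fun g _ => hx g

variable (k) in
/-- The norm-like polynomial `(1 - X) ^ e - (-X) ^ e`, divisible by `(1 - X) + X a` if
`a ^ e = 1`. -/
noncomputable def deformNorm (e : ℕ) : k[X] := (1 - X) ^ e - (-X) ^ e

theorem natDegree_one_sub_X_le : (1 - X : k[X]).natDegree ≤ 1 :=
  (natDegree_sub_le _ _).trans (by simpa using natDegree_X_le)

theorem natDegree_neg_X_le : (-X : k[X]).natDegree ≤ 1 := by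
  simpa using natDegree_X_le

theorem natDegree_deformNorm_le (e : ℕ) : (deformNorm k e).natDegree ≤ e := by
  refine (natDegree_sub_le _ _).trans (max_le ?_ ?_)
  · simpa using natDegree_pow_le_of_le e (natDegree_one_sub_X_le (k := k))
  · simpa using natDegree_pow_le_of_le e (natDegree_neg_X_le (k := k))

variable (k) in
/-- The deformation `(1 - X) + X a` from `1` (at `X = 0`) to `a` (at `X = 1`). -/
noncomputable def deform (a : G) : MonoidAlgebra k[X] G :=
  MonoidAlgebra.single 1 (1 - X) + MonoidAlgebra.single a X

variable (k) in
/-- The complementary factor of `deform k a` in `deformNorm k e`. -/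
noncomputable def codeform (e : ℕ) (a : G) : MonoidAlgebra k[X] G :=
  ∑ i ∈ Finset.range e,
    MonoidAlgebra.single 1 (1 - X) ^ i * MonoidAlgebra.single a (-X) ^ (e - 1 - i)

/-- The factorisation of `x ^ e - y ^ e` for the commuting elements `x = 1 - X` and `y = -X a`,
where `y ^ e = (-X) ^ e`. -/
theorem deform_mul_codeform {e : ℕ} {a : G} (h : a ^ e = 1) :
    deform k a * codeform k e a = MonoidAlgebra.single 1 (deformNorm k e) := by
  have hc : Commute (MonoidAlgebra.single (1 : G) (1 - X : k[X])) (MonoidAlgebra.single a (-X)) :=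
    MonoidAlgebra.single_commute_single (Commute.one_left a) (Commute.all _ _)
  have := hc.mul_geom_sum₂ e
  rw [MonoidAlgebra.single_pow, MonoidAlgebra.single_pow, h, one_pow, ← MonoidAlgebra.single_sub,
    MonoidAlgebra.single_neg, sub_neg_eq_add] at this
  rw [deform, codeform, deformNorm, MonoidAlgebra.single_neg]
  exact this

theorem coeffDegreeLE_deform (a : G) : CoeffDegreeLE 1 (deform k a) :=
  (coeffDegreeLE_single _ natDegree_one_sub_X_le).add (coeffDegreeLE_single _ natDegree_X_le)

theorem coeffDegreeLE_codeform (e : ℕ) (a : G) : CoeffDegreeLE e (codeform k e a) := by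
  refine CoeffDegreeLE.sum fun i hi => ?_
  rw [MonoidAlgebra.single_pow, MonoidAlgebra.single_pow]
  refine CoeffDegreeLE.mono ((coeffDegreeLE_single _ (natDegree_pow_le_of_le i
    natDegree_one_sub_X_le)).mul (coeffDegreeLE_single _ (natDegree_pow_le_of_le _
    natDegree_neg_X_le))) ?_
  have := Finset.mem_range.1 hi
  omega

variable (k) in
/-- The polynomial deformation of a letter `(i, b)`, scaled by `deformNorm k e`. -/
noncomputable def deformLetter {α : Type*} (e : ℕ) (f : FreeGroup α →* G) (l : α × Bool) :
    MonoidAlgebra k[X] G :=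
  if l.2 then deformNorm k e • deform k (f (.of l.1)) else codeform k e (f (.of l.1))

theorem coeffDegreeLE_deformLetter {α : Type*} (e : ℕ) (f : FreeGroup α →* G) (l : α × Bool) :
    CoeffDegreeLE (e + 1) (deformLetter k e f l) := by
  unfold deformLetter
  split_ifs
  · intro g
    rw [MonoidAlgebra.coeff_smul_apply, smul_eq_mul]
    exact natDegree_mul_le.trans (add_le_add (natDegree_deformNorm_le e) (coeffDegreeLE_deform _ g))
  · exact (coeffDegreeLE_codeform e _).mono (Nat.le_succ e)

variable (k) in
/-- The polynomial deformation of the image of a word. -/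
noncomputable def deformWord {α : Type*} (e : ℕ) (f : FreeGroup α →* G) (l : List (α × Bool)) :
    MonoidAlgebra k[X] G :=
  (l.map (deformLetter k e f)).prod

theorem coeffDegreeLE_deformWord {α : Type*} (e : ℕ) (f : FreeGroup α →* G)
    (l : List (α × Bool)) : CoeffDegreeLE ((e + 1) * l.length) (deformWord k e f l) := by
  induction l with
  | nil => exact coeffDegreeLE_single 1 (by simp)
  | cons a l ih =>
    rw [deformWord, List.map_cons, List.prod_cons]
    refine ((coeffDegreeLE_deformLetter e f a).mul ih).mono ?_
    rw [List.length_cons]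
    exact le_of_eq (by ring)

/-- An inverse letter is `codeform` divided by `deformNorm`; positive letters are scaled too, so
that the total factor depends only on the length. It is applied both to truncation and to evaluation
at `1`. -/
theorem mapRingHom_deformWord {α : Type*} {S : Type*} [CommRing S] (σ : k[X] →+* S) {e : ℕ}
    (f : FreeGroup α →* G) (hf : ∀ i, f (.of i) ^ e = 1)
    (θ : FreeGroup α →* (MonoidAlgebra S G)ˣ)
    (hθ : ∀ i, (θ (.of i) : MonoidAlgebra S G) =
      MonoidAlgebra.mapRingHom G σ (deform k (f (.of i)))) (l : List (α × Bool)) :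
    MonoidAlgebra.mapRingHom G σ (deformWord k e f l) =
      σ (deformNorm k e) ^ l.length • (θ (FreeGroup.mk l) : MonoidAlgebra S G) := by
  have hsmul (q : k[X]) (x : MonoidAlgebra k[X] G) :
      MonoidAlgebra.mapRingHom G σ (q • x) = σ q • MonoidAlgebra.mapRingHom G σ x := by
    ext; simp
  have hsingle (q : S) : MonoidAlgebra.single (1 : G) q = q • 1 := by
    simp [MonoidAlgebra.one_def]
  have hletter (i : α) (b : Bool) : MonoidAlgebra.mapRingHom G σ (deformLetter k e f (i, b)) =
      σ (deformNorm k e) • (θ (FreeGroup.mk [(i, b)]) : MonoidAlgebra S G) := by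
    cases b
    · have h1 := congrArg (MonoidAlgebra.mapRingHom G σ) (deform_mul_codeform (k := k) (hf i))
      rw [map_mul, ← hθ, MonoidAlgebra.mapRingHom_single, hsingle] at h1
      have h2 : FreeGroup.mk [(i, false)] = (FreeGroup.of i)⁻¹ := rfl
      rw [h2, map_inv, deformLetter, if_neg (by simp), ← mul_one (_ • _), smul_mul_assoc,
        ← mul_smul_comm, ← h1, Units.inv_mul_cancel_left]
    · rw [deformLetter, if_pos rfl, hsmul, ← hθ]
      rfl
  induction l with
  | nil => simp [deformWord, ← FreeGroup.one_eq_mk]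
  | cons a l ih =>
    obtain ⟨i, b⟩ := a
    have h3 : FreeGroup.mk ((i, b) :: l) = FreeGroup.mk [(i, b)] * FreeGroup.mk l := by
      rw [FreeGroup.mul_mk]; rfl
    rw [deformWord, List.map_cons, List.prod_cons, map_mul, hletter, ← deformWord, ih, h3,
      map_mul, Units.val_mul, smul_mul_smul_comm, List.length_cons, pow_succ']

end Deformation

/-! ### Units congruent to one modulo a nilpotent -/

section CongruenceSubgroup

variable {R : Type*} [CommRing R] {A : Type*} [Ring A] [Algebra R A]

variable (A) in
/-- The subgroup of units that are congruent to `1` modulo `s`. -/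
def congruenceUnits (s : R) : Subgroup Aˣ where
  carrier := {u | ∃ b : A, (u : A) = 1 + s • b}
  one_mem' := ⟨0, by simp⟩
  mul_mem' := by
    rintro u v ⟨b, hb⟩ ⟨c, hc⟩
    refine ⟨b + c + s • (b * c), ?_⟩
    rw [Units.val_mul, hb, hc]
    simp only [add_mul, mul_add, one_mul, mul_one, smul_mul_smul_comm, smul_add, smul_smul]
    abel
  inv_mem' := by
    rintro u ⟨b, hb⟩
    refine ⟨-(u⁻¹ * b), ?_⟩
    have h1 : (u⁻¹ : Aˣ) * (u : A) = 1 := u.inv_mul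
    rw [hb, mul_add, mul_one, mul_smul_comm] at h1
    rw [smul_neg, ← sub_eq_add_neg]
    exact eq_sub_of_add_eq h1

/-- In characteristic `p`, `(1 + s b) ^ (p ^ n) = 1 + s ^ (p ^ n) b ^ (p ^ n)`, and the last term
vanishes for large `n`. -/
theorem isPGroup_congruenceUnits {p : ℕ} [Fact p.Prime] [CharP A p] {s : R} (hs : IsNilpotent s) :
    IsPGroup p (congruenceUnits A s) := by
  obtain ⟨n, hn⟩ := hs
  rintro ⟨u, b, hb⟩
  refine ⟨n, Subtype.ext (Units.ext ?_)⟩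
  have hle : n ≤ p ^ n := (Nat.lt_pow_self (Fact.out : p.Prime).one_lt).le
  rw [SubgroupClass.coe_pow, Units.val_pow_eq_pow_val]
  simp only [hb]
  rw [add_pow_char_pow_of_commute p n (Commute.one_left _), _root_.smul_pow,
    pow_eq_zero_of_le hle hn]
  simp

theorem IsNilpotent.isUnit_one_add_smul {s : R} (hs : IsNilpotent s) (b : A) :
    IsUnit (1 + s • b) := by
  obtain ⟨m, hm⟩ := hs
  exact IsNilpotent.isUnit_one_add ⟨m, by rw [_root_.smul_pow, hm, zero_smul]⟩

end CongruenceSubgroup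

/-! ### Truncated polynomials and the transfer to `p`-groups -/

/-- The truncated polynomial ring `𝔽_p[X] / (X ^ n)`. -/
abbrev TruncPoly (p n : ℕ) : Type := (ZMod p)[X] ⧸ Ideal.span {(X : (ZMod p)[X]) ^ n}

section TruncPoly

variable (p n : ℕ)

theorem isNilpotent_mk_X : IsNilpotent (Ideal.Quotient.mk _ X : TruncPoly p n) :=
  ⟨n, by rw [← map_pow, Ideal.Quotient.eq_zero_iff_mem]; exact Ideal.mem_span_singleton_self _⟩

variable [Fact p.Prime]

theorem finite_truncPoly : Finite (TruncPoly p n) := by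
  have := (AdjoinRoot.powerBasis' (monic_X_pow (R := ZMod p) n)).finite
  exact Module.finite_of_finite (ZMod p) (M := AdjoinRoot ((X : (ZMod p)[X]) ^ n))

theorem card_truncPoly : Nat.card (TruncPoly p n) = p ^ n := by
  have := finite_truncPoly p n
  rw [Module.natCard_eq_pow_finrank (K := ZMod p), finrank_quotient_span_eq_natDegree]
  simp

variable {p n}

theorem eq_zero_of_mk_truncPoly_eq_zero {q : (ZMod p)[X]} (hq : q.natDegree < n)
    (h : (Ideal.Quotient.mk _ q : TruncPoly p n) = 0) : q = 0 := by
  rw [Ideal.Quotient.eq_zero_iff_dvd] at h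
  exact eq_zero_of_dvd_of_natDegree_lt h (by simpa using hq)

end TruncPoly

theorem card_monoidAlgebra {R G : Type*} [Semiring R] [Finite G] :
    Nat.card (MonoidAlgebra R G) = Nat.card R ^ Nat.card G := by
  rw [Nat.card_congr (MonoidAlgebra.coeffEquiv.trans Finsupp.equivFunOnFinite), Nat.card_fun]

/-- If a homomorphism from a free group to a finite group separates the conjugacy classes of two
elements, so does a homomorphism to a finite `p`-group, of an order bounded in terms of the order
of the finite group and the lengths of the elements. -/
theorem exists_isPGroup_not_isConj {α : Type*} [DecidableEq α] (p : ℕ) [Fact p.Prime]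
    {G : Type*} [Group G] [Finite G] (f : FreeGroup α →* G) {g h : FreeGroup α}
    (hgh : ¬ IsConj (f g) (f h)) :
    ∃ (U : Subgroup (MonoidAlgebra (TruncPoly p ((Nat.card G + 1) * (g.norm + h.norm) + 1)) G)ˣ)
      (ψ : FreeGroup α →* U), Finite U ∧ IsPGroup p U ∧
        Nat.card U ≤ (p ^ ((Nat.card G + 1) * (g.norm + h.norm) + 1)) ^ Nat.card G ∧
        ¬ IsConj (ψ g) (ψ h) := by
  classical
  have := Fintype.ofFinite G
  set e := Nat.card G with he
  -- One more than the degree bound for the polynomials compared below, so that truncation loses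
  -- nothing.
  set n := (e + 1) * (g.norm + h.norm) + 1 with hn
  have hpow (i : α) : f (.of i) ^ e = 1 := pow_card_eq_one'
  let σ : (ZMod p)[X] →+* TruncPoly p n := Ideal.Quotient.mk _
  have hnil : IsNilpotent (σ X) := isNilpotent_mk_X p n
  have : Finite (TruncPoly p n) := finite_truncPoly p n
  have : Finite (MonoidAlgebra (TruncPoly p n) G) :=
    .of_equiv _ (MonoidAlgebra.coeffEquiv.trans Finsupp.equivFunOnFinite).symm
  have : Nontrivial (TruncPoly p n) := by
    rw [← Finite.one_lt_card_iff_nontrivial, card_truncPoly]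
    exact Nat.one_lt_pow (by omega) (Fact.out : p.Prime).one_lt
  have : CharP (MonoidAlgebra (TruncPoly p n) G) p :=
    charP_of_injective_algebraMap (FaithfulSMul.algebraMap_injective (ZMod p) _) p
  have hdef (i : α) : MonoidAlgebra.mapRingHom G σ (deform (ZMod p) (f (.of i))) =
      1 + σ X • (MonoidAlgebra.single (f (.of i)) 1 - 1) := by
    ext g
    simp [deform, MonoidAlgebra.one_def, Finsupp.single_apply]
    split_ifs <;> simp [sub_eq_add_neg]; ring
  have hunit (i : α) :
      IsUnit (MonoidAlgebra.mapRingHom G σ (deform (ZMod p) (f (.of i)))) := by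
    rw [hdef]
    exact hnil.isUnit_one_add_smul _
  let ψ : FreeGroup α →* congruenceUnits (MonoidAlgebra (TruncPoly p n) G) (σ X) :=
    FreeGroup.lift fun i => ⟨(hunit i).unit, _, by rw [IsUnit.unit_spec, hdef]⟩
  refine ⟨_, ψ, inferInstance, isPGroup_congruenceUnits hnil, ?_, fun hconj => ?_⟩
  · rw [← card_truncPoly p n, ← card_monoidAlgebra]
    exact Nat.card_le_card_of_injective _ (Units.val_injective.comp Subtype.val_injective)
  let θ := (Subgroup.subtype _).comp ψ
  have hθ (i : α) : (θ (.of i) : MonoidAlgebra (TruncPoly p n) G) =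
      MonoidAlgebra.mapRingHom G σ (deform (ZMod p) (f (.of i))) := by
    simp [θ, ψ]
  -- The specialisation at `X = 1`, where the deformation of `a` is `a` itself.
  let θ₁ : FreeGroup α →* (MonoidAlgebra (ZMod p) G)ˣ :=
    ((MonoidAlgebra.of (ZMod p) G).comp f).toHomUnits
  let σ₁ : (ZMod p)[X] →+* ZMod p := evalRingHom 1
  have hθ₁ (i : α) : (θ₁ (.of i) : MonoidAlgebra (ZMod p) G) =
      MonoidAlgebra.mapRingHom G σ₁ (deform (ZMod p) (f (.of i))) := by
    simp [θ₁, σ₁, deform]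
  have key := mapRingHom_deformWord σ f hpow θ hθ
  have key₁ := mapRingHom_deformWord σ₁ f hpow θ₁ hθ₁
  let δ := deformNorm (ZMod p) e
  let τ (w : FreeGroup α) := classCoeff (ZMod p)[X] (f g) (deformWord (ZMod p) e f w.toWord)
  have hτ (w : FreeGroup α) : σ (τ w) = σ δ ^ w.norm *
      classCoeff _ (f g) (θ w : MonoidAlgebra (TruncPoly p n) G) := by
    rw [← classCoeff_mapRingHom, key, map_smul, FreeGroup.mk_toWord]; rfl
  have hτ₁ (w : FreeGroup α) : σ₁ (τ w) = σ₁ δ ^ w.norm *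
      if IsConj (f g) (f w) then 1 else 0 := by
    rw [← classCoeff_mapRingHom, key₁, map_smul, FreeGroup.mk_toWord, ← classCoeff_single]; rfl
  have hdeg (v w : FreeGroup α) : (δ ^ v.norm * τ w).natDegree ≤ (e + 1) * (v.norm + w.norm) := by
    refine natDegree_mul_le.trans ?_
    have h1 : (δ ^ v.norm).natDegree ≤ _ :=
      natDegree_pow_le_of_le v.norm (natDegree_deformNorm_le e)
    have h2 : (τ w).natDegree ≤ (e + 1) * w.norm :=
      (coeffDegreeLE_deformWord e f w.toWord).classCoeff (f g)
    nlinarith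
  -- After cross-multiplication both sides carry the same power of `δ`, so conjugacy in the
  -- `p`-group makes them agree modulo `X ^ n`.
  have hzero : δ ^ h.norm * τ g - δ ^ g.norm * τ h = 0 := by
    refine eq_zero_of_mk_truncPoly_eq_zero (n := n) ?_ ?_
    · refine Nat.lt_succ_of_le ((natDegree_sub_le _ _).trans (max_le ?_ (hdeg g h)))
      rw [add_comm g.norm]
      exact hdeg h g
    · change σ _ = 0
      have : IsConj (θ g) (θ h) := (Subgroup.subtype _).map_isConj hconj
      rw [map_sub, map_mul, map_mul, hτ, hτ, classCoeff_eq_of_isConj _ this, map_pow, map_pow]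
      ring
  have h₁ := congrArg σ₁ hzero
  -- Since `e ≠ 0`, the value of `δ` at `1` is `-(-1) ^ e`.
  have hδ : σ₁ δ ≠ 0 := by
    have : e ≠ 0 := Nat.card_pos.ne'
    simp [σ₁, δ, deformNorm, this]
  rw [map_sub, map_mul, map_mul, hτ₁, hτ₁, if_pos (IsConj.refl _), if_neg hgh] at h₁
  simp [hδ] at h₁

/-! ### Weighted action on a labelled cycle -/

section CyclicWord

variable {α : Type*} {n : ℕ}

/-- A cyclic word of length `n` without cancellation. -/
def IsCyclicReducedFun (u : ZMod n → α × Bool) : Prop :=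
  ∀ k, (u k).1 = (u (k + 1)).1 → (u k).2 = (u (k + 1)).2

/-- The edges labelled `a` have sources `s` and targets `t`. Two of them sharing a source or a
target would be adjacent with opposite signs, a cancellation in the cyclic word. -/
theorem IsCyclicReducedFun.exists_perm [NeZero n] {u : ZMod n → α × Bool}
    (hu : IsCyclicReducedFun u) (a : α) :
    ∃ σ : Equiv.Perm (ZMod n), ∀ k, (u k = (a, true) → σ (k + 1) = k) ∧
      (u k = (a, false) → σ k = k + 1) := by
  let s : {k // (u k).1 = a} → ZMod n := fun k => if (u k).2 then k + 1 else k
  let t : {k // (u k).1 = a} → ZMod n := fun k => if (u k).2 then k else k + 1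
  have hu' (k l : {k // (u k).1 = a}) (h : (k : ZMod n) + 1 = l) : (u k).2 = (u l).2 := by
    have := hu k
    rw [h, k.2, l.2] at this
    exact this rfl
  have hs : Function.Injective s := by
    intro k l h
    have h1 := hu' k l
    have h2 := hu' l k
    simp only [s] at h
    split_ifs at h <;> simp_all [Subtype.ext_iff]
  have ht : Function.Injective t := by
    intro k l h
    have h1 := hu' k l
    have h2 := hu' l k
    simp only [t] at h
    split_ifs at h <;> simp_all [Subtype.ext_iff]
  obtain ⟨σ, hσ⟩ := Equiv.Perm.exists_extending_pair s t hs ht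
  refine ⟨σ, fun k => ⟨fun h => ?_, fun h => ?_⟩⟩
  · simpa [s, t, h] using hσ ⟨k, by rw [h]⟩
  · simpa [s, t, h] using hσ ⟨k, by rw [h]⟩

open Classical in
/-- The weight of the edge of the generator `a` starting at the vertex `v` of the cycle labelled by
`u`: the signed indicator of the edge if it lies on the cycle, and zero otherwise. -/
noncomputable def edgeWeight (u : ZMod n → α × Bool) (a : α) (v : ZMod n) : ZMod n → ZMod 3 :=
  (if u (v - 1) = (a, true) then Pi.single (v - 1) 1 else 0) -
    if u v = (a, false) then Pi.single v 1 else 0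

/-- The permutations of `X × C` commuting with the translations of the second factor. -/
def translationCentralizer (X C : Type*) [AddCommGroup C] : Subgroup (Equiv.Perm (X × C)) where
  carrier := {π | ∀ x c t, π (x, c + t) = ((π (x, c)).1, (π (x, c)).2 + t)}
  one_mem' := fun _ _ _ => rfl
  mul_mem' := by
    intro π ρ hπ hρ x c t
    simp only [Equiv.Perm.mul_apply]
    rw [hρ, hπ]
  inv_mem' := by
    intro π hπ x c t
    rw [Equiv.Perm.inv_eq_iff_eq, hπ]
    simp

/-- The conjugator commutes with translations, so it carries `(x, c)` to a point shifted by the same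
`t`. -/
theorem translationCentralizer.exists_of_isConj {X C : Type*} [AddCommGroup C]
    {π ρ : translationCentralizer X C} (h : IsConj π ρ) {x : X} {c t : C}
    (hx : (π : Equiv.Perm (X × C)) (x, c) = (x, c + t)) :
    ∃ x' c', (ρ : Equiv.Perm (X × C)) (x', c') = (x', c' + t) := by
  obtain ⟨γ, rfl⟩ := isConj_iff.1 h
  refine ⟨((γ : Equiv.Perm (X × C)) (x, c)).1, ((γ : Equiv.Perm (X × C)) (x, c)).2, ?_⟩
  simp [hx, γ.2 x c t]

/-- The permutation of `X × C` given by a permutation `σ` of `X` and a `C`-valued weight on `X`. -/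
def weightedPerm {X C : Type*} [AddCommGroup C] (σ : Equiv.Perm X) (w : X → C) :
    translationCentralizer X C :=
  ⟨Equiv.prodShear σ fun x => Equiv.addRight (w x), fun x c t => by simp [add_right_comm]⟩

theorem weightedPerm_apply {X C : Type*} [AddCommGroup C] (σ : Equiv.Perm X) (w : X → C)
    (x : X) (c : C) :
    (weightedPerm σ w : Equiv.Perm (X × C)) (x, c) = (σ x, c + w x) := rfl

theorem weightedPerm_inv_apply {X C : Type*} [AddCommGroup C] (σ : Equiv.Perm X) (w : X → C)
    (x : X) (c : C) :
    ((weightedPerm σ w)⁻¹ : Equiv.Perm (X × C)) (σ x, c) = (x, c - w x) := by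
  rw [Equiv.Perm.inv_eq_iff_eq, weightedPerm_apply]
  simp

variable [NeZero n] {u : ZMod n → α × Bool} (hu : IsCyclicReducedFun u)

/-- The action of a free group on a weighted cover of the cycle labelled by `u`. -/
noncomputable def cycleAction :
    FreeGroup α →* translationCentralizer (ZMod n) (ZMod n → ZMod 3) :=
  FreeGroup.lift fun a => weightedPerm (hu.exists_perm a).choose (edgeWeight u a)

/-- The action of a word through `cycleAction`, as a permutation. -/
noncomputable def wordPerm (l : List (α × Bool)) : Equiv.Perm (ZMod n × (ZMod n → ZMod 3)) :=
  cycleAction hu (FreeGroup.mk l)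

theorem wordPerm_nil : wordPerm hu [] = 1 := by
  simp [wordPerm, ← FreeGroup.one_eq_mk]

theorem wordPerm_cons (a : α × Bool) (l : List (α × Bool)) :
    wordPerm hu (a :: l) = wordPerm hu [a] * wordPerm hu l := by
  simp only [wordPerm]
  rw [← Subgroup.coe_mul, ← map_mul, FreeGroup.mul_mk]
  rfl

theorem wordPerm_true (a : α) : wordPerm hu [(a, true)] =
    weightedPerm (hu.exists_perm a).choose (edgeWeight u a) := by
  change (cycleAction hu (FreeGroup.of a)).1 = _
  simp [cycleAction]

theorem wordPerm_false (a : α) : wordPerm hu [(a, false)] =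
    (weightedPerm (hu.exists_perm a).choose (edgeWeight u a) : Equiv.Perm _)⁻¹ := by
  change (cycleAction hu (FreeGroup.of a)⁻¹).1 = _
  simp [cycleAction]

/-- The letter `u k` moves along the cycle from `k + 1` to `k`. -/
theorem wordPerm_letter (k : ZMod n) (c : ZMod n → ZMod 3) :
    wordPerm hu [u k] (k + 1, c) = (k, c + Pi.single k 1) := by
  rcases h : u k with ⟨a, b⟩
  have hσ := (hu.exists_perm a).choose_spec k
  have h1 := hu k
  cases b
  · rw [wordPerm_false, ← hσ.2 h, weightedPerm_inv_apply]
    have h2 : u (k - 1) ≠ (a, true) := by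
      intro h3
      have := hu (k - 1)
      simp_all
    simp [edgeWeight, h, h2]
  · rw [wordPerm_true, weightedPerm_apply, hσ.1 h]
    have h2 : u (k + 1) ≠ (a, false) := by
      intro h3
      simp_all
    simp [edgeWeight, h, h2]

/-- Each letter changes the weight by zero or a signed unit vector, and with a positive sign only if
it moves along the cycle. -/
theorem wordPerm_letter_cases (a : α × Bool) (v : ZMod n) :
    ∃ (v' : ZMod n) (w : ZMod n → ZMod 3),
      (∀ c, wordPerm hu [a] (v, c) = (v', c + w)) ∧
      (w = 0 ∨ (∃ k, w = -Pi.single k 1) ∨ (v = v' + 1 ∧ u v' = a ∧ w = Pi.single v' 1)) := by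
  obtain ⟨a, b⟩ := a
  set σ := (hu.exists_perm a).choose with hσdef
  have hσ := (hu.exists_perm a).choose_spec
  have hexcl (k : ZMod n) (h : u (k - 1) = (a, true)) : u k ≠ (a, false) := by
    intro h'
    have := hu (k - 1)
    simp_all
  cases b
  · obtain ⟨v, rfl⟩ := σ.surjective v
    refine ⟨v, -edgeWeight u a v, fun c => ?_, ?_⟩
    · rw [wordPerm_false, weightedPerm_inv_apply, sub_eq_add_neg]
    · by_cases h : u v = (a, false)
      · have h' : u (v - 1) ≠ (a, true) := fun h' => hexcl v h' h
        exact .inr (.inr ⟨(hσ v).2 h, h, by simp [edgeWeight, h, h']⟩)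
      · by_cases h' : u (v - 1) = (a, true)
        · exact .inr (.inl ⟨v - 1, by simp [edgeWeight, h, h']⟩)
        · exact .inl (by simp [edgeWeight, h, h'])
  · refine ⟨σ v, edgeWeight u a v, fun c => ?_, ?_⟩
    · rw [wordPerm_true, weightedPerm_apply]
    · by_cases h : u (v - 1) = (a, true)
      · have h1 : σ v = v - 1 := by simpa using (hσ (v - 1)).1 h
        exact .inr (.inr ⟨by simp [h1], by rw [h1, h], by simp [edgeWeight, h, h1, hexcl v h]⟩)
      · by_cases h' : u v = (a, false)
        · exact .inr (.inl ⟨v, by simp [edgeWeight, h, h']⟩)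
        · exact .inl (by simp [edgeWeight, h, h'])

/-- The last letter acts first, so the path starts at `k + l.length` and descends to `k`. -/
theorem wordPerm_subword (l : List (α × Bool)) (k : ZMod n)
    (hl : ∀ i (hi : i < l.length), l[i] = u (k + i)) (c : ZMod n → ZMod 3) :
    wordPerm hu l (k + l.length, c) = (k, c + ∑ i ∈ Finset.range l.length, Pi.single (k + i) 1) := by
  induction l generalizing k with
  | nil => simp [wordPerm_nil]
  | cons a l ih =>
    have ha : a = u k := by
      rw [← add_zero k, ← Nat.cast_zero]
      exact hl 0 (by simp)
    have h1 := ih (k + 1) fun i hi => by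
      have := hl (i + 1) (by simpa using hi)
      simpa [add_assoc, add_comm (1 : ZMod n)] using this
    rw [wordPerm_cons, Equiv.Perm.mul_apply, List.length_cons, Nat.cast_succ,
      add_comm (l.length : ZMod n), ← add_assoc, h1, ha, wordPerm_letter, Finset.sum_range_succ']
    simp [add_assoc, add_comm (1 : ZMod n)]

/-- If a word changes the weight at as many places as it has letters, always to `1`, then it moves
along the cycle. -/
theorem wordPerm_eq_subword (l : List (α × Bool)) (v : ZMod n) :
    ∃ (v' : ZMod n) (w : ZMod n → ZMod 3), (∀ c, wordPerm hu l (v, c) = (v', c + w)) ∧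
      (Finset.univ.filter (w · ≠ 0)).card ≤ l.length ∧
      ((Finset.univ.filter (w · ≠ 0)).card = l.length → (∀ k, w k = 0 ∨ w k = 1) →
        v = v' + l.length ∧ ∀ i (hi : i < l.length), l[i] = u (v' + i)) := by
  induction l with
  | nil => exact ⟨v, 0, by simp [wordPerm_nil]⟩
  | cons a l ih =>
    obtain ⟨v', w, h1, h2, h3⟩ := ih
    obtain ⟨v'', x, h4, h5⟩ := wordPerm_letter_cases hu a v'
    obtain ⟨k, y, hx, hy⟩ : ∃ k y, x = Pi.single k y ∧
        (y = 1 → v' = v'' + 1 ∧ u v'' = a) := by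
      rcases h5 with rfl | ⟨k, rfl⟩ | ⟨h6, h7, rfl⟩
      · exact ⟨0, 0, by simp, by simp⟩
      -- Here the modulus `3` matters: `-1 ≠ 1`.
      · exact ⟨k, -1, by rw [Pi.single_neg], fun h => absurd h (by decide)⟩
      · exact ⟨v'', 1, rfl, fun _ => ⟨h6, h7⟩⟩
    subst hx
    have hsub : (Finset.univ.filter fun j => (w + Pi.single k y : ZMod n → ZMod 3) j ≠ 0) ⊆
        insert k (Finset.univ.filter (w · ≠ 0)) := by
      intro j hj
      by_cases hjk : j = k
      · simp [hjk]
      · simpa [hjk] using hj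
    refine ⟨v'', w + Pi.single k y, fun c => ?_, ?_, fun hcard hval => ?_⟩
    · rw [wordPerm_cons, Equiv.Perm.mul_apply, h1, h4, add_assoc]
    · exact (Finset.card_le_card hsub).trans ((Finset.card_insert_le _ _).trans
        (Nat.succ_le_succ h2))
    · rw [List.length_cons] at hcard
      -- The support must grow with every letter, so each letter acts at a fresh place and its
      -- contribution there is final.
      have hk : w k = 0 := by
        by_contra hk
        have h6 := Finset.card_le_card hsub
        rw [Finset.insert_eq_of_mem (by simpa using hk)] at h6
        omega
      have h6 : (Finset.univ.filter (w · ≠ 0)).card = l.length := by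
        have := (Finset.card_le_card hsub).trans (Finset.card_insert_le _ _)
        omega
      have hyk : y ≠ 0 := by
        rintro rfl
        simp only [Pi.single_zero, add_zero] at hcard
        omega
      have h7 := h3 h6 fun j => by
        by_cases hjk : j = k
        · exact .inl (hjk ▸ hk)
        · simpa [hjk] using hval j
      have h8 := hy (by simpa [hk, hyk] using hval k)
      refine ⟨?_, fun i hi => ?_⟩
      · rw [h7.1, h8.1, List.length_cons, Nat.cast_succ]
        ring
      · cases i with
        | zero => simp [h8.2]
        | succ i =>
          rw [List.getElem_cons_succ, h7.2 i (by simpa using hi), h8.1]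
          push_cast
          congr 1
          ring

end CyclicWord

/-! ### Separating conjugacy classes in a finite group -/

section Separation

variable {α : Type*}

theorem FreeGroup.isConj_mk_rotate (l : List (α × Bool)) (j : ℕ) :
    IsConj (FreeGroup.mk l) (FreeGroup.mk (l.rotate j)) := by
  rw [← List.rotate_mod]
  rcases l.eq_nil_or_concat with rfl | ⟨l', x, rfl⟩
  · simp only [List.rotate_nil]
    exact IsConj.refl _
  rw [List.concat_eq_append]
  have hj : j % (l' ++ [x]).length ≤ (l' ++ [x]).length := (Nat.mod_lt _ (by simp)).le
  generalize l' ++ [x] = m at hj ⊢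
  rw [List.rotate_eq_drop_append_take hj]
  conv_lhs => rw [← List.take_append_drop (j % m.length) m]
  rw [← FreeGroup.mul_mk, ← FreeGroup.mul_mk]
  exact isConj_mul_comm _ _

/-- The cyclic word given by a list. -/
def cyclicFun (l : List (α × Bool)) [NeZero l.length] (k : ZMod l.length) : α × Bool :=
  l[k.val]'(ZMod.val_lt k)

theorem isCyclicReducedFun_cyclicFun {l : List (α × Bool)} [NeZero l.length]
    (hl : FreeGroup.IsCyclicallyReduced l) : IsCyclicReducedFun (cyclicFun l) := by
  intro k
  have hk := ZMod.val_lt k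
  have hval : (k + 1).val = (k.val + 1) % l.length := by
    rw [ZMod.val_add, ZMod.val_one_eq_one_mod, Nat.add_mod_mod]
  simp only [cyclicFun, hval]
  by_cases h : k.val + 1 < l.length
  · simp only [Nat.mod_eq_of_lt h]
    exact List.isChain_iff_getElem.1 hl.1 k.val h
  · have h1 : k.val + 1 = l.length := by omega
    simp only [h1, Nat.mod_self]
    refine hl.2 _ ?_ _ ?_
    · have h2 : l.length - 1 = k.val := by omega
      rw [List.getLast?_eq_getElem?, h2]
      simp
    · rw [List.head?_eq_getElem?]
      simp

/-- A cyclically reduced word is separated from all non-conjugate words that are not longer by the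
action on the weighted cycle it labels. -/
theorem not_isConj_cycleAction {L l : List (α × Bool)} [NeZero L.length]
    (hL : FreeGroup.IsCyclicallyReduced L) (hl : l.length ≤ L.length)
    (hc : ¬ IsConj (FreeGroup.mk L) (FreeGroup.mk l)) :
    ¬ IsConj (cycleAction (isCyclicReducedFun_cyclicFun hL) (FreeGroup.mk L))
      (cycleAction (isCyclicReducedFun_cyclicFun hL) (FreeGroup.mk l)) := by
  set hu := isCyclicReducedFun_cyclicFun hL
  intro h
  have hcast : ((L.length : ℕ) : ZMod L.length) = 0 := ZMod.natCast_self _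
  have h1 : wordPerm hu L (0, 0) = (0, 0 + 1) := by
    have := wordPerm_subword hu L 0 (fun i hi => by
      simp [cyclicFun, ZMod.val_natCast, Nat.mod_eq_of_lt hi]) 0
    rw [hcast, add_zero] at this
    rw [this]
    congr 2
    ext v : 1
    rw [Finset.sum_apply, Finset.sum_eq_single v.val]
    · simp
    · intro i hi hne
      refine Pi.single_eq_of_ne ?_ _
      rintro rfl
      refine hne ?_
      simp [ZMod.val_natCast, Nat.mod_eq_of_lt (Finset.mem_range.1 hi)]
    · intro hv
      exact absurd (Finset.mem_range.2 (ZMod.val_lt v)) hv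
  obtain ⟨v, c, h2⟩ := translationCentralizer.exists_of_isConj h h1
  obtain ⟨v', w, h3, h4, h5⟩ := wordPerm_eq_subword hu l v
  have h6 := h2.symm.trans (h3 c)
  rw [Prod.mk.injEq, add_right_inj] at h6
  obtain ⟨rfl, rfl⟩ := h6
  have hcard : (Finset.univ.filter
      ((1 : ZMod L.length → ZMod 3) · ≠ 0)).card = L.length := by
    simp [ZMod.card]
  -- The all-ones weight has `L.length` nonzero entries, and a word changes at most as many as it
  -- has letters.
  have hlen : l.length = L.length := by omega
  have h7 := (h5 (by omega) fun k => .inr rfl).2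
  refine hc ?_
  convert FreeGroup.isConj_mk_rotate L v.val
  refine List.ext_getElem (by simp [hlen]) fun i hi hi' => ?_
  rw [h7 i hi, List.getElem_rotate]
  simp [cyclicFun, ZMod.val_add, ZMod.val_natCast, add_comm]

theorem FreeGroup.isConj_mk_reduceCyclically [DecidableEq α] (g : FreeGroup α) :
    IsConj g (FreeGroup.mk (FreeGroup.reduceCyclically g.toWord)) := by
  refine (isConj_iff.2 ⟨FreeGroup.mk (FreeGroup.reduceCyclically.conjugator g.toWord), ?_⟩).symm
  rw [FreeGroup.inv_mk, FreeGroup.mul_mk, FreeGroup.mul_mk,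
    FreeGroup.reduceCyclically.conj_conjugator_reduceCyclically, FreeGroup.mk_toWord]

theorem FreeGroup.length_reduceCyclically_le [DecidableEq α] (l : List (α × Bool)) :
    (FreeGroup.reduceCyclically l).length ≤ l.length := by
  conv_rhs => rw [← FreeGroup.reduceCyclically.conj_conjugator_reduceCyclically l]
  simp only [List.length_append]
  omega

/-- Non-conjugate elements of a free group have non-conjugate images in a group of permutations of
an explicit finite set, the size of which depends only on the length of the elements. -/
theorem exists_perm_not_isConj [DecidableEq α] {g h : FreeGroup α} (hgh : ¬ IsConj g h) :
    ∃ n, n ≤ g.norm + h.norm ∧ n ≠ 0 ∧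
      ∃ f : FreeGroup α →* translationCentralizer (ZMod n) (ZMod n → ZMod 3),
        ¬ IsConj (f g) (f h) := by
  wlog hlen : (FreeGroup.reduceCyclically h.toWord).length ≤
    (FreeGroup.reduceCyclically g.toWord).length generalizing g h
  · obtain ⟨n, h1, h2, f, hf⟩ := this (fun hc => hgh hc.symm) (not_le.1 hlen).le
    exact ⟨n, by omega, h2, f, fun hc => hf hc.symm⟩
  set L := FreeGroup.reduceCyclically g.toWord with hLdef
  set l := FreeGroup.reduceCyclically h.toWord with hldef
  have hg : IsConj g (FreeGroup.mk L) := FreeGroup.isConj_mk_reduceCyclically g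
  have hh : IsConj h (FreeGroup.mk l) := FreeGroup.isConj_mk_reduceCyclically h
  have hc : ¬ IsConj (FreeGroup.mk L) (FreeGroup.mk l) := fun hc =>
    hgh ((hg.trans hc).trans hh.symm)
  have hL0 : L.length ≠ 0 := by
    intro h0
    have hl0 : l.length = 0 := by omega
    rw [List.length_eq_zero_iff] at h0 hl0
    exact hc (by rw [h0, hl0])
  have : NeZero L.length := ⟨hL0⟩
  have hL : FreeGroup.IsCyclicallyReduced L :=
    FreeGroup.reduceCyclically.isCyclicallyReduced FreeGroup.isReduced_toWord
  refine ⟨L.length, (FreeGroup.length_reduceCyclically_le _).trans (Nat.le_add_right _ _), hL0,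
    cycleAction (isCyclicReducedFun_cyclicFun hL), fun hconj => ?_⟩
  exact not_isConj_cycleAction hL hlen hc
    (((MonoidHom.map_isConj _ hg).symm.trans hconj).trans (MonoidHom.map_isConj _ hh))

end Separation

/-! ### Primitive recursive bounds -/

section Bound

/-- A bound for the order of a separating finite quotient of a free group. -/
def permBound (n : ℕ) : ℕ := (n * 3 ^ n) ^ (n * 3 ^ n)

/-- A bound for the order of a separating `p`-group quotient of a free group. -/
def pGroupBound (p n : ℕ) : ℕ := (p ^ ((permBound n + 1) * n + 1)) ^ permBound n

theorem primrec_natPow : Primrec₂ ((· ^ ·) : ℕ → ℕ → ℕ) :=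
  Primrec₂.unpaired'.1 Nat.Primrec.pow

theorem primrec_permBound : Primrec permBound := by
  have h : Primrec fun n : ℕ => n * 3 ^ n :=
    Primrec.nat_mul.comp .id (primrec_natPow.comp (.const 3) .id)
  exact primrec_natPow.comp h h

theorem primrec_pGroupBound (p : ℕ) : Primrec (pGroupBound p) :=
  primrec_natPow.comp (primrec_natPow.comp (.const p) (Primrec.succ.comp
    (Primrec.nat_mul.comp (Primrec.succ.comp primrec_permBound) .id))) primrec_permBound

theorem permBound_mono : Monotone permBound := by
  intro m n h
  -- `permBound 0` is `0 ^ 0 = 1`, so this case needs positivity of `permBound n`.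
  rcases Nat.eq_zero_or_pos m with rfl | hm
  · have : 0 < permBound n := by
      unfold permBound
      rcases Nat.eq_zero_or_pos n with rfl | hn
      · simp
      · positivity
    simpa [permBound] using Nat.succ_le_of_lt this
  · have h1 : m * 3 ^ m ≤ n * 3 ^ n := Nat.mul_le_mul h (Nat.pow_le_pow_right (by simp) h)
    have h2 : 0 < n * 3 ^ n := Nat.mul_pos (hm.trans_le h) (by positivity)
    exact (Nat.pow_le_pow_left h1 _).trans (Nat.pow_le_pow_right h2 h1)

theorem pGroupBound_mono_aux {p : ℕ} (hp : 0 < p) {a b m n : ℕ} (hab : a ≤ b) (hmn : m ≤ n) :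
    (p ^ ((a + 1) * m + 1)) ^ a ≤ (p ^ ((b + 1) * n + 1)) ^ b := by
  rw [← pow_mul, ← pow_mul]
  exact Nat.pow_le_pow_right hp (by gcongr)

theorem pGroupBound_mono {p : ℕ} (hp : 0 < p) : Monotone (pGroupBound p) := fun _ _ h =>
  pGroupBound_mono_aux hp (permBound_mono h) h

theorem pGroupBound_pos {p : ℕ} (hp : 0 < p) (n : ℕ) : 0 < pGroupBound p n := by
  unfold pGroupBound; positivity

end Bound

/-- A crude count of all self-maps of a set with `n * 3 ^ n` elements. -/
theorem card_translationCentralizer_le {n : ℕ} [NeZero n] :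
    Nat.card (translationCentralizer (ZMod n) (ZMod n → ZMod 3)) ≤ permBound n := by
  refine (Nat.card_le_card_of_injective (fun π : translationCentralizer (ZMod n)
    (ZMod n → ZMod 3) => ⇑π.1) (DFunLike.coe_injective.comp Subtype.val_injective)).trans ?_
  rw [Nat.card_fun, Nat.card_prod, Nat.card_fun]
  simp [permBound]

theorem separatesConj_ker {F U : Type*} [Group F] [Group U] (ψ : F →* U) {g h : F}
    (hψ : ¬ IsConj (ψ g) (ψ h)) : SeparatesConj ψ.ker g h := fun hc =>
  hψ ((QuotientGroup.kerLift ψ).map_isConj hc)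

/-- Free groups are conjugacy `p`-separable, with an explicit bound that does not depend on the
rank. -/
theorem FreeGroup.exists_normal_isPGroup_not_isConj {α : Type*} [DecidableEq α] {p : ℕ}
    (hp : p.Prime) {g h : FreeGroup α} (hgh : ¬ IsConj g h) :
    ∃ (K : Subgroup (FreeGroup α)) (_ : K.Normal), Finite (FreeGroup α ⧸ K) ∧
      IsPGroup p (FreeGroup α ⧸ K) ∧
      Nat.card (FreeGroup α ⧸ K) ≤ pGroupBound p (g.norm + h.norm) ∧ SeparatesConj K g h := by
  have : Fact p.Prime := ⟨hp⟩
  obtain ⟨n, hn, hn0, f, hf⟩ := exists_perm_not_isConj hgh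
  have : NeZero n := ⟨hn0⟩
  obtain ⟨U, ψ, hfin, hU, hcard, hψ⟩ := exists_isPGroup_not_isConj p f hf
  have hinj := QuotientGroup.kerLift_injective ψ
  refine ⟨ψ.ker, inferInstance, .of_injective _ hinj, hU.of_injective _ hinj, ?_,
    separatesConj_ker ψ hψ⟩
  exact (Nat.card_le_card_of_injective _ hinj).trans (hcard.trans
    (pGroupBound_mono_aux hp.pos (card_translationCentralizer_le.trans (permBound_mono hn)) le_rfl))

/-! ### Characteristic subgroups from kernels -/

section CharacteristicCore

variable {F : Type*} [Group F]

/-- The intersection of the kernels of all homomorphisms to a group `Q`. -/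
def homKer (F Q : Type*) [Group F] [Group Q] : Subgroup F := ⨅ f : F →* Q, f.ker

theorem mem_homKer {Q : Type*} [Group Q] {x : F} : x ∈ homKer F Q ↔ ∀ f : F →* Q, f x = 1 := by
  simp [homKer, Subgroup.mem_iInf, MonoidHom.mem_ker]

instance homKer_characteristic {Q : Type*} [Group Q] : (homKer F Q).Characteristic := by
  refine Subgroup.characteristic_iff_le_comap.2 fun φ x hx => ?_
  rw [Subgroup.mem_comap, mem_homKer]
  exact fun f => mem_homKer.1 hx (f.comp φ.toMonoidHom)

theorem homKer_quotient_le (K : Subgroup F) [K.Normal] : homKer F (F ⧸ K) ≤ K := fun x hx => by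
  simpa using mem_homKer.1 hx (QuotientGroup.mk' K)

/-- The quotient by `homKer` embeds into a power of the target. -/
def homKerEmbedding (F Q : Type*) [Group F] [Group Q] : F ⧸ homKer F Q →* ((F →* Q) → Q) :=
  QuotientGroup.lift _ (MonoidHom.pi fun f => f) fun x hx => by
    ext f
    exact mem_homKer.1 hx f

theorem homKerEmbedding_injective (F Q : Type*) [Group F] [Group Q] :
    Function.Injective (homKerEmbedding F Q) := by
  rw [injective_iff_map_eq_one]
  intro x
  induction x using QuotientGroup.induction_on with
  | H x =>
    intro h
    rw [QuotientGroup.eq_one_iff, mem_homKer]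
    exact fun f => congrFun h f

theorem IsPGroup.pi {p : ℕ} {ι Q : Type*} [Finite ι] [Group Q] (h : IsPGroup p Q) :
    IsPGroup p (ι → Q) := by
  intro x
  choose k hk using fun i => h (x i)
  have := Fintype.ofFinite ι
  refine ⟨∑ i, k i, funext fun i => ?_⟩
  obtain ⟨c, hc⟩ := pow_dvd_pow p (Finset.single_le_sum (f := k) (fun _ _ => Nat.zero_le _)
    (Finset.mem_univ i))
  rw [Pi.pow_apply, hc, pow_mul, hk, one_pow, Pi.one_apply]

theorem SeparatesConj.mono {K L : Subgroup F} [K.Normal] [L.Normal] (hLK : L ≤ K) {g h : F}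
    (hK : SeparatesConj K g h) : SeparatesConj L g h := fun hc =>
  hK ((QuotientGroup.map L K (MonoidHom.id F) hLK).map_isConj hc)

/-- In a free group of finite rank `m`, a normal subgroup of `p`-power index `q` contains a
characteristic subgroup of `p`-power index at most `q ^ q ^ m`. -/
theorem FreeGroupBasis.exists_characteristic_le {ι : Type*} [Finite ι] (b : FreeGroupBasis ι F)
    {p : ℕ} (K : Subgroup F) [K.Normal] [Finite (F ⧸ K)] (hK : IsPGroup p (F ⧸ K)) :
    ∃ (L : Subgroup F) (_ : L.Characteristic), L ≤ K ∧ Finite (F ⧸ L) ∧ IsPGroup p (F ⧸ L) ∧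
      Nat.card (F ⧸ L) ≤ Nat.card (F ⧸ K) ^ (Nat.card (F ⧸ K) ^ Nat.card ι) := by
  have e : (F →* F ⧸ K) ≃ (ι → F ⧸ K) := b.lift.symm
  have : Finite (F →* F ⧸ K) := .of_equiv _ e.symm
  have hinj := homKerEmbedding_injective F (F ⧸ K)
  refine ⟨homKer F (F ⧸ K), inferInstance, homKer_quotient_le K, .of_injective _ hinj,
    hK.pi.of_injective _ hinj, ?_⟩
  refine (Nat.card_le_card_of_injective _ hinj).trans ?_
  rw [Nat.card_fun, Nat.card_congr e, Nat.card_fun]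

end CharacteristicCore

/-! ### Word length and change of generators -/

section WordLength

variable {G : Type*} [Group G]

/-- In a group generated by `S`, the word length is attained. -/
theorem exists_list_length_eq_wordLength {S : Set G} (hS : Subgroup.closure S = ⊤) (g : G) :
    ∃ l : List G, l.length = wordLength S g ∧ (∀ x ∈ l, x ∈ S ∨ x⁻¹ ∈ S) ∧ l.prod = g := by
  obtain ⟨l, hl, hg⟩ := Submonoid.exists_list_of_mem_closure (s := S ∪ S⁻¹) (x := g)
    (by rw [← Subgroup.closure_toSubmonoid, hS]; trivial)
  exact Nat.sInf_mem (s := {n | ∃ l : List G, l.length = n ∧ (∀ x ∈ l, x ∈ S ∨ x⁻¹ ∈ S) ∧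
    l.prod = g}) ⟨_, l, rfl, hl, hg⟩

/-- A homomorphism to a free group that maps generators to elements of norm at most `c` multiplies
lengths at most by `c`. -/
theorem norm_le_mul_wordLength {α : Type*} [DecidableEq α] (f : G →* FreeGroup α) {S : Set G}
    (hS : Subgroup.closure S = ⊤) {c : ℕ} (hc : ∀ x ∈ S, (f x).norm ≤ c) (g : G) :
    (f g).norm ≤ c * wordLength S g := by
  obtain ⟨l, hlen, hl, rfl⟩ := exists_list_length_eq_wordLength hS g
  rw [← hlen]
  clear hlen
  induction l with
  | nil => simp
  | cons a l ih =>
    rw [List.prod_cons, map_mul, List.length_cons]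
    have ha : (f a).norm ≤ c := by
      rcases hl a (by simp) with h | h
      · exact hc a h
      · have := hc _ h
        rwa [map_inv, FreeGroup.norm_inv_eq] at this
    have := ih fun x hx => hl x (List.mem_cons_of_mem _ hx)
    have := FreeGroup.norm_mul_le (f a) (f l.prod)
    linarith

theorem FreeGroupBasis.closure_range {ι : Type*} (b : FreeGroupBasis ι G) :
    Subgroup.closure (Set.range b) = ⊤ := by
  have h : Set.range b = b.repr.symm.toMonoidHom '' Set.range FreeGroup.of := by
    rw [← Set.range_comp]; rfl
  rw [h, ← MonoidHom.map_closure, FreeGroup.closure_range_of]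
  exact Subgroup.map_top_of_surjective _ b.repr.symm.surjective

theorem FreeGroupBasis.norm_repr_le_wordLength {ι : Type*} [DecidableEq ι]
    (b : FreeGroupBasis ι G) (g : G) : (b.repr g).norm ≤ wordLength (Set.range b) g := by
  rw [← one_mul (wordLength _ _)]
  refine norm_le_mul_wordLength b.repr.toMonoidHom b.closure_range ?_ g
  rintro _ ⟨i, rfl⟩
  simp

/-- A basis of a finitely generated free group is finite. -/
theorem FreeGroupBasis.finite_of_fg {ι : Type*} (b : FreeGroupBasis ι G) [Group.FG G] :
    Finite ι := by
  obtain ⟨S, hS, hfin⟩ := Group.fg_iff.1 ‹Group.FG G›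
  -- In the free abelian group on the basis, finitely many generators involve finitely many
  -- coordinates, yet every basis element must lie in their span.
  let φ : G →* Multiplicative (ι →₀ ℤ) := b.lift fun i => .ofAdd (Finsupp.single i 1)
  have hT : (⋃ x ∈ S, ((φ x).toAdd.support : Set ι)).Finite :=
    hfin.biUnion fun x _ => Finset.finite_toSet _
  let H := (Finsupp.supported ℤ ℤ
    (⋃ x ∈ S, ((φ x).toAdd.support : Set ι))).toAddSubgroup.toSubgroup.comap φ
  have hH : H = ⊤ := by
    rw [eq_top_iff, ← hS, Subgroup.closure_le]
    intro x hx
    exact (Finsupp.mem_supported ℤ _).2 (Set.subset_biUnion_of_mem (u := fun x =>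
      ((φ x).toAdd.support : Set ι)) hx)
  refine Set.finite_univ_iff.1 (hT.subset fun i _ => ?_)
  have hi : b i ∈ H := hH ▸ Subgroup.mem_top _
  refine (Finsupp.mem_supported ℤ _).1 hi ?_
  simp [φ]

end WordLength

/-! ### Effective separability of free groups -/

theorem FreeGroupBasis.exists_normal_isPGroup_separatesConj {ι F : Type*} [Group F]
    (b : FreeGroupBasis ι F) [DecidableEq ι] {p : ℕ} (hp : p.Prime) {g h : F}
    (hgh : ¬ IsConj g h) :
    ∃ (K : Subgroup F) (_ : K.Normal), Finite (F ⧸ K) ∧ IsPGroup p (F ⧸ K) ∧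
      Nat.card (F ⧸ K) ≤ pGroupBound p ((b.repr g).norm + (b.repr h).norm) ∧
      SeparatesConj K g h := by
  have hgh' : ¬ IsConj (b.repr g) (b.repr h) := fun hc => hgh <| by
    simpa using b.repr.symm.toMonoidHom.map_isConj hc
  obtain ⟨K, hK, hfin, hp, hcard, hsep⟩ := FreeGroup.exists_normal_isPGroup_not_isConj hp hgh'
  let φ := (QuotientGroup.mk' K).comp b.repr.toMonoidHom
  have hinj := QuotientGroup.kerLift_injective φ
  exact ⟨φ.ker, inferInstance, .of_injective _ hinj, hp.of_injective _ hinj,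
    (Nat.card_le_card_of_injective _ hinj).trans hcard,
    fun hc => hsep ((QuotientGroup.kerLift φ).map_isConj hc)⟩

theorem effectivelyCharPConjugacySeparable_of_isFreeGroup {p : ℕ} (hp : p.Prime) (F : Type*)
    [Group F] [IsFreeGroup F] [Group.FG F] : EffectivelyCharPConjugacySeparable p F := by
  classical
  refine ⟨inferInstance, fun S hfin hS => ?_⟩
  let b := IsFreeGroup.basis F
  have : Finite (IsFreeGroup.Generators F) := b.finite_of_fg
  -- `c` and the rank `m` depend only on `F` and `S`, so they enter the bound as constants and do
  -- not affect computability.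
  obtain ⟨c, hc⟩ := (hfin.image fun x => (b.repr x).norm).bddAbove
  have hnorm := norm_le_mul_wordLength b.repr.toMonoidHom hS fun x hx => hc ⟨x, hx, rfl⟩
  let m := Nat.card (IsFreeGroup.Generators F)
  have hB : Primrec fun n : ℕ => pGroupBound p (c * n) :=
    (primrec_pGroupBound p).comp (Primrec.nat_mul.comp (.const c) .id)
  refine ⟨fun n => pGroupBound p (c * n) ^ pGroupBound p (c * n) ^ m,
    (primrec_natPow.comp hB (primrec_natPow.comp hB (.const m))).to_comp, fun g h hgh => ?_⟩
  obtain ⟨K, _, _, hpK, hcard, hsep⟩ := b.exists_normal_isPGroup_separatesConj hp hgh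
  obtain ⟨L, hL, hLK, hfinL, hpL, hcardL⟩ := b.exists_characteristic_le K hpK
  refine ⟨L, hL, hfinL, hpL, hcardL.trans ?_, hsep.mono hLK⟩
  have hle : Nat.card (F ⧸ K) ≤ pGroupBound p (c * (wordLength S g + wordLength S h)) := by
    refine hcard.trans (pGroupBound_mono hp.pos ?_)
    rw [mul_add]
    exact add_le_add (hnorm g) (hnorm h)
  exact (Nat.pow_le_pow_left hle _).trans (Nat.pow_le_pow_right (pGroupBound_pos hp.pos _)
    (Nat.pow_le_pow_left hle _))

theorem EffectivelyCharPConjugacySeparable.effectivelyConjugacySeparable {p : ℕ} {G : Type*}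
    [Group G] (h : EffectivelyCharPConjugacySeparable p G) : EffectivelyConjugacySeparable G := by
  refine ⟨h.1, fun S hfin hS => ?_⟩
  obtain ⟨B, hB, h⟩ := h.2 S hfin hS
  refine ⟨B, hB, fun g g' hg => ?_⟩
  obtain ⟨K, hK, h1, -, h2, h3⟩ := h g g' hg
  exact ⟨K, inferInstance, h1, h2, h3⟩

theorem proposition5p4 :
    -- finitely generated free groups are effectively conjugacy separable
    (∀ (F : Type*) [Group F] [IsFreeGroup F] [Group.FG F], EffectivelyConjugacySeparable F) ∧
    ∀ p : ℕ, p.Prime → 2 < p →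
      -- ... through characteristic `p`-group quotients
      (∀ (F : Type*) [Group F] [IsFreeGroup F] [Group.FG F],
        EffectivelyCharPConjugacySeparable p F) ∧
      -- for word length in a free basis, one bound serves free groups of all finite ranks, and
      -- passing to a characteristic quotient replaces the order `q` by at most `q ^ (q ^ rank)`
      (∃ B : ℕ → ℕ, Computable B ∧
        ∀ (ι : Type*) (F : Type*) [Finite ι] [Group F] (b : FreeGroupBasis ι F) (g h : F),
          ¬ IsConj g h →
          ∃ (K : Subgroup F) (_ : K.Normal), Finite (F ⧸ K) ∧ IsPGroup p (F ⧸ K) ∧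
            Nat.card (F ⧸ K) ≤ B (wordLength (Set.range b) g + wordLength (Set.range b) h) ∧
            SeparatesConj K g h ∧
            ∃ (L : Subgroup F) (_ : L.Characteristic), L ≤ K ∧
              Finite (F ⧸ L) ∧ IsPGroup p (F ⧸ L) ∧
              Nat.card (F ⧸ L) ≤ Nat.card (F ⧸ K) ^ (Nat.card (F ⧸ K) ^ Nat.card ι) ∧
              SeparatesConj L g h) := by
  -- The first claim follows from the refined one for any single prime, here `3`.
  refine ⟨fun F _ _ _ => (effectivelyCharPConjugacySeparable_of_isFreeGroup Nat.prime_three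
    F).effectivelyConjugacySeparable, fun p hp _ => ⟨fun F _ _ _ =>
    effectivelyCharPConjugacySeparable_of_isFreeGroup hp F, pGroupBound p,
    (primrec_pGroupBound p).to_comp, fun ι F _ _ b g h hgh => ?_⟩⟩
  classical
  obtain ⟨K, _, _, hpK, hcard, hsep⟩ := b.exists_normal_isPGroup_separatesConj hp hgh
  obtain ⟨L, hL, hLK, hfinL, hpL, hcardL⟩ := b.exists_characteristic_le K hpK
  exact ⟨K, inferInstance, inferInstance, hpK, hcard.trans (pGroupBound_mono hp.pos
    (add_le_add (b.norm_repr_le_wordLength g) (b.norm_repr_le_wordLength h))), hsep,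
    L, hL, hLK, hfinL, hpL, hcardL, hsep.mono hLK⟩
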